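/- Let $E$ be a measurable space, let $n\ge 0$, and let $\psi:E\to\mathbb{R}^n$ be a measurable bijection with measurable inverse ($\mathbb{R}^n$ with its Borel $\sigma$-algebra). For probability measures $\nu,\mu$ on $E$ let $$W_2^\psi(\nu,\mu):=W_2(\psi_*\nu,\psi_*\mu)=\Bigl(\inf_{\pi\in\Pi(\nu,\mu)}\int_{E\times E}\|\psi(x)-\psi(y)\|^2\,d\pi(x,y)\Bigr)^{1/2}\in[0,\infty],$$ where $\psi_*$ denotes the pushforward, $\|\cdot\|$ is the Euclidean norm, $\Pi(\nu,\mu)$ is the set of couplings of $\nu$ and $\mu$ (measures on $E\times E$ with marginals $\nu$ and $\mu$), and $W_2$ is the $2$-Wasserstein distance on $\mathbb{R}^n$ for the Euclidean distance. For $\nu\ll\mu$ let $D(\nu\|\mu):=\int_E\log\frac{d\nu}{d\mu}\,d\nu\in[0,\infty]$ be the relative entropy. **Theorem 8.1 ($\psi$-$T_2$ inequality).** If $\mu$ is a probability measure on $E$ such that $\psi_*\mu=\gamma$ is the standard Gaussian measure on $\mathbb{R}^n$, then for every probability measure $\nu$ on $E$ with $\nu\ll\mu$, $$W_2^\psi(\nu,\mu)\le\sqrt{2D(\nu\|\mu)}.$$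 -/

import Mathlib

open MeasureTheory ProbabilityTheory InformationTheory
open scoped ENNReal

/-- `π` is a coupling of `μ` and `ν`: a measure on the product space whose first and second
marginals are `μ` and `ν`. -/
def IsCoupling {X Y : Type*} [MeasurableSpace X] [MeasurableSpace Y]
    (π : Measure (X × Y)) (μ : Measure X) (ν : Measure Y) : Prop :=
  π.map Prod.fst = μ ∧ π.map Prod.snd = ν

/-- The `p`-Wasserstein distance
`W_p(μ, ν) = (inf over couplings π of ∫ d(x, y)^p dπ(x, y))^(1/p)`, with values in `[0, ∞]`. -/
noncomputable def wasserstein {X : Type*} [MeasurableSpace X] [PseudoEMetricSpace X]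
    (p : ℝ) (μ ν : Measure X) : ℝ≥0∞ :=
  (⨅ (π : Measure (X × X)) (_ : IsCoupling π μ ν), ∫⁻ z, edist z.1 z.2 ^ p ∂π) ^ (1 / p)

/-- The `ψ`-Wasserstein distance `W_p^ψ(μ, ν) = W_p(ψ_* μ, ψ_* ν)` of two measures on `E`, where
`ψ : E → ℝⁿ` is a measurable bijection with measurable inverse and `ℝⁿ` carries the Euclidean
distance. -/
noncomputable def psiWasserstein {E : Type*} [MeasurableSpace E] {n : ℕ} (p : ℝ)
    (ψ : E ≃ᵐ EuclideanSpace ℝ (Fin n)) (μ ν : Measure E) : ℝ≥0∞ :=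
  wasserstein p (μ.map ψ) (ν.map ψ)

/-- The `ψ`-Wasserstein distance is the optimal transport cost on `E` itself for the ground cost
`‖ψ x - ψ y‖ ^ p`. -/
theorem psiWasserstein_eq_iInf {E : Type*} [MeasurableSpace E] {n : ℕ} (p : ℝ)
    (ψ : E ≃ᵐ EuclideanSpace ℝ (Fin n)) (μ ν : Measure E) :
    psiWasserstein p ψ μ ν =
      (⨅ (π : Measure (E × E)) (_ : IsCoupling π μ ν), ∫⁻ z, ‖ψ z.1 - ψ z.2‖ₑ ^ p ∂π)
        ^ (1 / p) := by
  unfold psiWasserstein wasserstein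
  congr 1
  apply le_antisymm
  · refine le_iInf₂ fun π hπ => ?_
    refine iInf₂_le_of_le (π.map (ψ.prodCongr ψ)) ⟨?_, ?_⟩ ?_
    · rw [← hπ.1, Measure.map_map measurable_fst (by fun_prop),
        Measure.map_map (by fun_prop) measurable_fst]
      rfl
    · rw [← hπ.2, Measure.map_map measurable_snd (by fun_prop),
        Measure.map_map (by fun_prop) measurable_snd]
      rfl
    · rw [lintegral_map_equiv]
      simp only [edist_eq_enorm_sub]
      exact le_rfl
  · refine le_iInf₂ fun π hπ => ?_
    refine iInf₂_le_of_le (π.map (ψ.symm.prodCongr ψ.symm)) ⟨?_, ?_⟩ ?_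
    · rw [Measure.map_map measurable_fst (by fun_prop)]
      have h : (Prod.fst ∘ (ψ.symm.prodCongr ψ.symm)) = ψ.symm ∘ Prod.fst := rfl
      rw [h, ← Measure.map_map (by fun_prop) measurable_fst, hπ.1,
        MeasurableEquiv.map_symm_map]
    · rw [Measure.map_map measurable_snd (by fun_prop)]
      have h : (Prod.snd ∘ (ψ.symm.prodCongr ψ.symm)) = ψ.symm ∘ Prod.snd := rfl
      rw [h, ← Measure.map_map (by fun_prop) measurable_snd, hπ.2,
        MeasurableEquiv.map_symm_map]
    · rw [lintegral_map_equiv]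
      simp [edist_eq_enorm_sub, MeasurableEquiv.prodCongr]

/-! ### Distribution functions of atomless probability measures on the line -/

section CDF

open Set

/-! Through `ψ` the claim becomes Talagrand's inequality on `ℝⁿ`, and it suffices to find one map
pushing `ν` to the Gaussian `γ` with squared cost at most `2 D(ν‖γ)`.

On the line this map is the increasing rearrangement `S`. Let `f = dν/dγ` and let `φ` be the
Gaussian density. Formally `f φ = φ(S) S'`, so `r = φ(S) / (f φ)` stands for `1 / S'`, and `log r =
(x² - S²)/2 - log f`. Integrating `log r ≤ r - 1` against `ν` gives `(∫ x² dν - 1)/2 - D ≤ ∫ r dν -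
1`. Moreover `∫ r dν ≤ ∫ x S dν` (`integral_gaussianRatio_le`), an integration by parts carried out
with Fubini, so `S` is never differentiated. Together these say `½ ∫ (x - S)² dν ≤ D`.

For product spaces, `ν` is disintegrated: the first marginal and the conditional laws are
transported separately, the costs add, and the chain rule adds the entropies
(`TransportInequality.prod_gaussianReal`). Induction on `n` concludes. -/

theorem continuous_real_Iic (ν : Measure ℝ) [IsProbabilityMeasure ν] [NullSingletonClass ν] :
    Continuous fun x => ν.real (Iic x) := by
  have h : (fun x => ν.real (Iic x)) = cdf ν := funext fun x => (cdf_eq_real ν x).symm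
  rw [h, continuous_iff_continuousAt]
  intro x
  rw [(monotone_cdf ν).continuousAt_iff_leftLim_eq_rightLim]
  have h1 := (cdf ν).measure_singleton x
  rw [measure_cdf, measure_singleton, eq_comm, ENNReal.ofReal_eq_zero] at h1
  have h2 : Function.rightLim (cdf ν) x = cdf ν x := (cdf ν).rightLim_eq x
  have h3 := (monotone_cdf ν).leftLim_le (le_refl x)
  linarith

theorem monotone_real_Iic (ν : Measure ℝ) [IsProbabilityMeasure ν] :
    Monotone fun x => ν.real (Iic x) :=
  fun _ _ h => measureReal_mono (Iic_subset_Iic.2 h)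

theorem exists_real_Iic_eq (ν : Measure ℝ) [IsProbabilityMeasure ν] [NullSingletonClass ν] {u : ℝ}
    (hu : u ∈ Ioo 0 1) : ∃ x, ν.real (Iic x) = u := by
  obtain ⟨a, ha⟩ := ((tendsto_cdf_atBot ν).eventually_lt_const hu.1).exists
  obtain ⟨b, hb⟩ := ((tendsto_cdf_atTop ν).eventually_const_lt hu.2).exists
  rw [cdf_eq_real] at ha hb
  exact mem_range_of_exists_le_of_exists_ge (continuous_real_Iic ν) ⟨a, ha.le⟩ ⟨b, hb.le⟩

/-- Probability integral transform. The distribution function may have flat pieces, so the sublevel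
set is squeezed between `Iic x₀` and `Iic (sSup s)`, both of mass `u`. -/
theorem real_setOf_real_Iic_le (ν : Measure ℝ) [IsProbabilityMeasure ν] [NullSingletonClass ν] {u : ℝ}
    (hu : u ∈ Ioo 0 1) : ν.real {x | ν.real (Iic x) ≤ u} = u := by
  obtain ⟨x₀, hx₀⟩ := exists_real_Iic_eq ν hu
  set s := {x | ν.real (Iic x) ≤ u} with hs
  have hcl : IsClosed s := isClosed_le (continuous_real_Iic ν) continuous_const
  have hbdd : BddAbove s := by
    obtain ⟨b, hb⟩ := ((tendsto_cdf_atTop ν).eventually_const_lt hu.2).exists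
    refine ⟨b, fun x hx => ?_⟩
    by_contra! hlt
    have h1 := monotone_cdf ν hlt.le
    rw [cdf_eq_real ν x] at h1
    have : ν.real (Iic x) ≤ u := hx
    linarith
  have hne : s.Nonempty := ⟨x₀, hx₀.le⟩
  have hmem : sSup s ∈ s := hcl.csSup_mem hne hbdd
  refine le_antisymm ?_ ?_
  · exact (measureReal_mono fun x hx => le_csSup hbdd hx : ν.real s ≤ ν.real (Iic (sSup s))).trans
      hmem
  · rw [← hx₀]
    exact measureReal_mono fun x hx => (monotone_real_Iic ν hx).trans hx₀.le

theorem ae_real_Iic_mem_Ioo (ν : Measure ℝ) [IsProbabilityMeasure ν] [NullSingletonClass ν] :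
    ∀ᵐ x ∂ν, ν.real (Iic x) ∈ Ioo (0 : ℝ) 1 := by
  have h0 : ∀ᵐ x ∂ν, 0 < ν.real (Iic x) := by
    rw [ae_iff, ← measureReal_eq_zero_iff]
    refine le_antisymm (le_of_forall_gt_imp_ge_of_dense fun u hu => ?_) measureReal_nonneg
    -- Truncating at `1 / 2` keeps the level inside `(0, 1)`.
    have hv : min u (1 / 2) ∈ Ioo (0 : ℝ) 1 :=
      ⟨lt_min hu (by norm_num), (min_le_right _ _).trans_lt (by norm_num)⟩
    calc _ ≤ ν.real {x | ν.real (Iic x) ≤ min u (1 / 2)} :=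
          measureReal_mono fun x hx => (not_lt.1 hx).trans hv.1.le
      _ = min u (1 / 2) := real_setOf_real_Iic_le ν hv
      _ ≤ u := min_le_left _ _
  have h1 : ∀ᵐ x ∂ν, ν.real (Iic x) < 1 := by
    have hms : MeasurableSet {x | ν.real (Iic x) < 1} :=
      measurableSet_lt (continuous_real_Iic ν).measurable measurable_const
    refine (mem_ae_iff_prob_eq_one hms).2 ?_
    rw [← ENNReal.toReal_eq_one_iff]
    refine le_antisymm measureReal_le_one (le_of_forall_lt_imp_le_of_dense fun u hu => ?_)
    have hv : max u (1 / 2) ∈ Ioo (0 : ℝ) 1 :=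
      ⟨(by norm_num : (0 : ℝ) < 1 / 2).trans_le (le_max_right _ _), max_lt hu (by norm_num)⟩
    calc u ≤ max u (1 / 2) := le_max_left _ _
      _ = ν.real {x | ν.real (Iic x) ≤ max u (1 / 2)} := (real_setOf_real_Iic_le ν hv).symm
      _ ≤ ν.real {x | ν.real (Iic x) < 1} := measureReal_mono fun x hx => lt_of_le_of_lt hx hv.2
  filter_upwards [h0, h1] with x hx hx' using ⟨hx, hx'⟩

end CDF

/-! ### Gaussian quantile function and increasing rearrangement -/

section Quantile

open Set

instance : NullSingletonClass (gaussianReal 0 1) := nullSingletonClass_gaussianReal one_ne_zero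

theorem real_gaussianReal_Iic_strictMono : StrictMono fun x => (gaussianReal 0 1).real (Iic x) := by
  intro a b hab
  have h : 0 < (gaussianReal 0 1).real (Ioc a b) := by
    rw [measureReal_def, ENNReal.toReal_pos_iff]
    refine ⟨pos_iff_ne_zero.2 fun h => ?_, measure_lt_top _ _⟩
    have := gaussianReal_absolutelyContinuous' 0 one_ne_zero h
    simp at this
    linarith
  have h2 := measureReal_union (μ := gaussianReal 0 1) (Iic_disjoint_Ioc (le_refl a) (c := b))
    measurableSet_Ioc
  rw [Iic_union_Ioc_eq_Iic hab.le] at h2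
  show _ < _
  dsimp only
  linarith

theorem real_gaussianReal_Iic_mem_Ioo (x : ℝ) : (gaussianReal 0 1).real (Iic x) ∈ Ioo (0 : ℝ) 1 :=
  ⟨measureReal_nonneg.trans_lt (real_gaussianReal_Iic_strictMono (sub_one_lt x)),
    (real_gaussianReal_Iic_strictMono (lt_add_one x)).trans_le measureReal_le_one⟩

/-- The quantile function of the standard Gaussian measure on `ℝ`. Its values outside `(0, 1)` are
irrelevant. -/
noncomputable def gaussianQuantile (u : ℝ) : ℝ :=
  Function.invFun (fun x => (gaussianReal 0 1).real (Iic x)) u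

theorem real_Iic_gaussianQuantile {u : ℝ} (hu : u ∈ Ioo 0 1) :
    (gaussianReal 0 1).real (Iic (gaussianQuantile u)) = u :=
  Function.invFun_eq (f := fun x => (gaussianReal 0 1).real (Iic x)) (exists_real_Iic_eq _ hu)

theorem gaussianQuantile_le_iff {u : ℝ} (hu : u ∈ Ioo 0 1) {t : ℝ} :
    gaussianQuantile u ≤ t ↔ u ≤ (gaussianReal 0 1).real (Iic t) := by
  rw [← real_gaussianReal_Iic_strictMono.le_iff_le, real_Iic_gaussianQuantile hu]

theorem measurable_gaussianQuantile : Measurable gaussianQuantile := by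
  -- Levels outside `(0, 1)` are not attained, so `Function.invFun` returns the same default value
  -- at all of them.
  have hconst : ∀ u ∉ Ioo (0 : ℝ) 1, gaussianQuantile u = gaussianQuantile 0 := by
    have key : ∀ u ∉ Ioo (0 : ℝ) 1, ¬ ∃ x, (gaussianReal 0 1).real (Iic x) = u := by
      rintro u hu ⟨x, rfl⟩
      exact hu (real_gaussianReal_Iic_mem_Ioo x)
    intro u hu
    exact (Function.invFun_neg (key u hu)).trans (Function.invFun_neg (key 0 (by simp))).symm
  refine measurable_of_Iic fun t => ?_
  have : gaussianQuantile ⁻¹' Iic t = (Ioo 0 1 ∩ Iic ((gaussianReal 0 1).real (Iic t))) ∪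
      ((Ioo 0 1)ᶜ ∩ {_u | gaussianQuantile 0 ≤ t}) := by
    ext u
    by_cases hu : u ∈ Ioo (0 : ℝ) 1
    · simp only [mem_preimage, mem_Iic, gaussianQuantile_le_iff hu, mem_union, mem_inter_iff, hu,
        mem_compl_iff, true_and, not_true, false_and, or_false]
    · simp only [mem_preimage, mem_Iic, hconst u hu, mem_union, mem_inter_iff, hu,
        mem_compl_iff, true_and, not_false_iff, false_and, false_or, mem_ofPred_eq]
  rw [this]
  measurability

/-- The increasing rearrangement pushing an atomless probability measure `ν` on `ℝ` to the standard
Gaussian measure. -/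
noncomputable def gaussianRearrangement (ν : Measure ℝ) (x : ℝ) : ℝ :=
  gaussianQuantile (ν.real (Iic x))

/-- Joint measurability lets the rearrangements of the conditional laws be glued into one measurable
map. -/
theorem measurable_gaussianRearrangement_kernel {X : Type*} [MeasurableSpace X] (κ : Kernel X ℝ)
    [IsSFiniteKernel κ] : Measurable fun p : X × ℝ => gaussianRearrangement (κ p.1) p.2 := by
  refine measurable_gaussianQuantile.comp (Measurable.ennreal_toReal ?_)
  have hs : MeasurableSet {q : (X × ℝ) × ℝ | q.2 ≤ q.1.2} :=
    measurableSet_le (by fun_prop) (by fun_prop)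
  exact Kernel.measurable_kernel_prodMk_left (κ := κ.prodMkRight ℝ) hs

theorem measurable_gaussianRearrangement (ν : Measure ℝ) [IsProbabilityMeasure ν] :
    Measurable (gaussianRearrangement ν) :=
  measurable_gaussianQuantile.comp (monotone_real_Iic ν).measurable

theorem gaussianRearrangement_le_iff {ν : Measure ℝ} {x t : ℝ} (hx : ν.real (Iic x) ∈ Ioo (0 : ℝ) 1) :
    gaussianRearrangement ν x ≤ t ↔ ν.real (Iic x) ≤ (gaussianReal 0 1).real (Iic t) :=
  gaussianQuantile_le_iff hx

theorem map_gaussianRearrangement {ν : Measure ℝ} [IsProbabilityMeasure ν]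
    [NullSingletonClass ν] :
    ν.map (gaussianRearrangement ν) = gaussianReal 0 1 := by
  have := Measure.isProbabilityMeasure_map (μ := ν) (measurable_gaussianRearrangement ν).aemeasurable
  refine Measure.ext_of_Iic _ _ fun t => ?_
  rw [Measure.map_apply (measurable_gaussianRearrangement ν) measurableSet_Iic,
    ← measureReal_eq_measureReal_iff, ← real_setOf_real_Iic_le ν (real_gaussianReal_Iic_mem_Ioo t)]
  refine measureReal_congr ?_
  filter_upwards [ae_real_Iic_mem_Ioo ν] with x hx
  exact propext (gaussianRearrangement_le_iff hx)

/-- The rearrangement may be constant on `ν`-null intervals, so equality holds only almost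
everywhere: one inclusion, plus equal masses. -/
theorem Ioi_ae_eq_setOf_lt_gaussianRearrangement {ν : Measure ℝ} [IsProbabilityMeasure ν]
    [NullSingletonClass ν] {x : ℝ}
    (hx : ν.real (Iic x) ∈ Ioo (0 : ℝ) 1) :
    {t | gaussianRearrangement ν x < gaussianRearrangement ν t} =ᵐ[ν] Ioi x := by
  have hm := measurable_gaussianRearrangement ν
  refine ae_eq_of_ae_subset_of_measure_ge ?_ (le_of_eq ?_)
    (measurableSet_lt measurable_const hm).nullMeasurableSet (measure_ne_top _ _)
  · filter_upwards [ae_real_Iic_mem_Ioo ν] with t ht hlt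
    by_contra hle
    refine not_le.2 hlt ((gaussianRearrangement_le_iff ht).2 ?_)
    rw [gaussianRearrangement, real_Iic_gaussianQuantile hx]
    exact monotone_real_Iic ν (not_lt.1 hle)
  · have h1 : ν.real (Ioi x) = 1 - ν.real (Iic x) := by
      rw [← compl_Iic, probReal_compl_eq_one_sub measurableSet_Iic]
    have h2 : ν.real {t | gaussianRearrangement ν x < gaussianRearrangement ν t} =
        1 - ν.real (Iic x) := by
      have : {t | gaussianRearrangement ν x < gaussianRearrangement ν t} =
          gaussianRearrangement ν ⁻¹' (Ioi (gaussianRearrangement ν x)) := rfl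
      rw [this, ← map_measureReal_apply hm measurableSet_Ioi, map_gaussianRearrangement,
        ← compl_Iic, probReal_compl_eq_one_sub measurableSet_Iic, gaussianRearrangement,
        real_Iic_gaussianQuantile hx]
    rw [← measureReal_eq_measureReal_iff, h1, h2]

end Quantile


/-! ### Gaussian integrals and entropy bounds on the line -/

section GaussianLine

open Set Filter Topology

theorem gaussianPDFReal_zero_one (x : ℝ) :
    gaussianPDFReal 0 1 x = (√(2 * Real.pi))⁻¹ * Real.exp (-x ^ 2 / 2) := by
  simp [gaussianPDFReal]

theorem log_gaussianPDFReal_zero_one (x : ℝ) :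
    Real.log (gaussianPDFReal 0 1 x) = Real.log (√(2 * Real.pi))⁻¹ - x ^ 2 / 2 := by
  rw [gaussianPDFReal_zero_one, Real.log_mul (by positivity) (by positivity), Real.log_exp]
  ring

theorem hasDerivAt_gaussianPDFReal (x : ℝ) :
    HasDerivAt (gaussianPDFReal 0 1) (-(x * gaussianPDFReal 0 1 x)) x := by
  have h := ((((hasDerivAt_id x).pow 2).neg.div_const 2).exp).const_mul (√(2 * Real.pi))⁻¹
  refine (h.congr_deriv ?_).congr_of_eventuallyEq (Eventually.of_forall fun y => ?_)
  · rw [gaussianPDFReal_zero_one]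
    simp
    ring
  · rw [gaussianPDFReal_zero_one]; simp

theorem tendsto_gaussianPDFReal_atTop : Tendsto (gaussianPDFReal 0 1) atTop (𝓝 0) := by
  have h : Tendsto (fun x : ℝ => -x ^ 2 / 2) atTop atBot := by
    simp_rw [neg_div]
    exact tendsto_neg_atTop_atBot.comp
      ((tendsto_pow_atTop two_ne_zero).atTop_div_const two_pos)
  have := (Real.tendsto_exp_atBot.comp h).const_mul (√(2 * Real.pi))⁻¹
  rw [mul_zero] at this
  exact this.congr fun x => (gaussianPDFReal_zero_one x).symm

theorem setIntegral_Ioi_id_gaussianReal (s : ℝ) :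
    ∫ y in Ioi s, y ∂(gaussianReal 0 1) = gaussianPDFReal 0 1 s := by
  have hint : Integrable (fun y : ℝ => y * gaussianPDFReal 0 1 y) := by
    have h := memLp_id_gaussianReal (μ := 0) (v := 1) 1
    have h' : Integrable (fun y : ℝ => y) (gaussianReal 0 1) := 
      memLp_one_iff_integrable.1 (by simpa [Function.id_def] using h)
    rw [gaussianReal_of_var_ne_zero _ one_ne_zero, integrable_withDensity_iff
      (measurable_gaussianPDF 0 1) (ae_of_all _ fun _ => gaussianPDF_lt_top)] at h'
    simpa using h'
  rw [gaussianReal_of_var_ne_zero _ one_ne_zero, restrict_withDensity measurableSet_Ioi,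
    integral_withDensity_eq_integral_toReal_smul (measurable_gaussianPDF 0 1)
      (ae_of_all _ fun _ => gaussianPDF_lt_top)]
  have := integral_Ioi_of_hasDerivAt_of_tendsto' (a := s)
    (fun x _ => (hasDerivAt_gaussianPDFReal x).neg)
    (by simpa using hint.integrableOn) tendsto_gaussianPDFReal_atTop.neg
  simpa [mul_comm] using this

/-- A finite relative entropy with respect to `γ` transfers exponential integrability under `γ` to
integrability. -/
theorem integrable_of_integrable_llr {X : Type*} [MeasurableSpace X] {ν γ : Measure X}
    [IsFiniteMeasure ν] [IsFiniteMeasure γ] (hν : ν ≪ γ) (h : Integrable (llr ν γ) ν) {g : X → ℝ}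
    (hg : Measurable g) (hg0 : 0 ≤ g) (hexp : Integrable (fun x => Real.exp (g x)) γ) :
    Integrable g ν := by
  rw [← integrable_toReal_rnDeriv_mul_iff hν]
  have hk := (integrable_klFun_rnDeriv_iff hν).2 h
  refine (hk.add hexp).mono' (by fun_prop) (ae_of_all _ fun x => ?_)
  set a := (ν.rnDeriv γ x).toReal
  have ha : 0 ≤ a := ENNReal.toReal_nonneg
  have hgx : 0 ≤ g x := hg0 x
  change ‖a * g x‖ ≤ klFun a + Real.exp (g x)
  rw [Real.norm_of_nonneg (mul_nonneg ha hgx), klFun_apply]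
  rcases ha.eq_or_lt with h0 | h0
  · have := Real.exp_pos (g x)
    rw [← h0, zero_mul, zero_mul]
    linarith
  · have h1 := Real.add_one_le_exp (g x - Real.log a)
    rw [Real.exp_sub, Real.exp_log h0, le_div_iff₀ h0] at h1
    nlinarith

theorem integrable_sq_of_integrable_llr {ν : Measure ℝ} [IsFiniteMeasure ν]
    (hν : ν ≪ gaussianReal 0 1) (h : Integrable (llr ν (gaussianReal 0 1)) ν) :
    Integrable (fun x => x ^ 2) ν := by
  -- Fernique's theorem.
  obtain ⟨C, hC, hint⟩ := IsGaussian.exists_integrable_exp_sq (gaussianReal 0 1)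
  have := (integrable_of_integrable_llr hν h (g := fun x => C * ‖x‖ ^ 2) (by fun_prop)
    (fun x => by positivity) hint).const_mul C⁻¹
  refine this.congr (ae_of_all _ fun x => ?_)
  simp [hC.ne']

/-- Fubini applied to `t = ∫ k t x dx`, where `k t` is the indicator of `(0, t)` minus that of `[t,
0]`. For `x ≤ 0` the kernel yields `-∫_{t ≤ x} g dν`, which is the upper tail integral because `g`
has mean zero. -/
theorem integral_setIntegral_Ioi {ν : Measure ℝ} [IsFiniteMeasure ν] {g : ℝ → ℝ}
    (hg : Integrable g ν) (hg0 : ∫ t, g t ∂ν = 0) (htg : Integrable (fun t => t * g t) ν) :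
    Integrable (fun x => ∫ t in Ioi x, g t ∂ν) ∧
      ∫ x, ∫ t in Ioi x, g t ∂ν = ∫ t, t * g t ∂ν := by
  let k : ℝ → ℝ → ℝ := fun t x =>
    if 0 < x then (if x < t then 1 else 0) else (if t ≤ x then -1 else 0)
  have hkm : Measurable (Function.uncurry k) :=
    Measurable.ite (measurableSet_lt measurable_const measurable_snd)
      (Measurable.ite (measurableSet_lt measurable_snd measurable_fst) measurable_const
        measurable_const)
      (Measurable.ite (measurableSet_le measurable_fst measurable_snd) measurable_const
        measurable_const)
  have hk : ∀ t, k t = fun x => (Ioo 0 t).indicator (fun _ => (1 : ℝ)) x -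
      (Icc t 0).indicator (fun _ => (1 : ℝ)) x := by
    intro t
    funext x
    simp only [k, indicator, mem_Ioo, mem_Icc]
    split_ifs <;> first | (norm_num; done) | (exfalso; grind)
  have hkabs : ∀ t, (fun x => ‖k t x‖) = fun x => (Ioo 0 t).indicator (fun _ => (1 : ℝ)) x +
      (Icc t 0).indicator (fun _ => (1 : ℝ)) x := by
    intro t
    funext x
    simp only [k, indicator, mem_Ioo, mem_Icc]
    split_ifs <;> first | (norm_num; done) | (exfalso; grind)
  have hi1 : ∀ t : ℝ, Integrable ((Ioo 0 t).indicator (fun _ => (1 : ℝ))) := fun t =>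
    (integrable_indicator_iff measurableSet_Ioo).2 (integrableOn_const (by simp))
  have hi2 : ∀ t : ℝ, Integrable ((Icc t 0).indicator (fun _ => (1 : ℝ))) := fun t =>
    (integrable_indicator_iff measurableSet_Icc).2 (integrableOn_const (by simp))
  have hk_int : ∀ t, ∫ x, k t x = t := by
    intro t
    rw [hk, integral_sub (hi1 t) (hi2 t), integral_indicator measurableSet_Ioo,
      integral_indicator measurableSet_Icc]
    rcases le_total 0 t with h | h <;> simp [h]
  have hkabs_int : ∀ t, ∫ x, ‖k t x‖ = |t| := by
    intro t
    rw [hkabs, integral_add (hi1 t) (hi2 t), integral_indicator measurableSet_Ioo,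
      integral_indicator measurableSet_Icc]
    rcases le_total 0 t with h | h <;> simp [h, abs_of_nonneg, abs_of_nonpos]
  have hm : ∀ x, ∫ t, g t * k t x ∂ν = ∫ t in Ioi x, g t ∂ν := by
    intro x
    by_cases hx : 0 < x
    · rw [← integral_indicator measurableSet_Ioi]
      refine integral_congr_ae (ae_of_all _ fun t => ?_)
      simp [k, hx, indicator]
    · have h1 := integral_add_compl (measurableSet_Ioi (a := x)) hg
      rw [hg0, compl_Ioi] at h1
      have h2 : ∫ t, g t * k t x ∂ν = -∫ t in Iic x, g t ∂ν := by
        rw [← integral_indicator measurableSet_Iic, ← integral_neg]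
        refine integral_congr_ae (ae_of_all _ fun t => ?_)
        by_cases ht : t ≤ x <;> simp [k, hx, ht]
      linarith
  have hF : Integrable (fun p : ℝ × ℝ => g p.1 * k p.1 p.2) (ν.prod volume) := by
    refine (integrable_prod_iff (f := fun p : ℝ × ℝ => g p.1 * k p.1 p.2)
      (hg.1.comp_fst.mul hkm.aestronglyMeasurable)).2 ⟨?_, ?_⟩
    · refine ae_of_all _ fun t => Integrable.const_mul (f := k t) ?_ (g t)
      rw [hk]
      exact (hi1 t).sub (hi2 t)
    · refine htg.norm.congr (ae_of_all _ fun t => ?_)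
      simp only [norm_mul, integral_const_mul, hkabs_int]
      rw [Real.norm_eq_abs t, mul_comm]
  have hr := hF.integral_prod_right
  simp only [hm] at hr
  refine ⟨hr, ?_⟩
  have := integral_integral_swap (f := fun t x => g t * k t x) hF
  simp only [hm, integral_const_mul, hk_int] at this
  rw [← this]
  simp_rw [mul_comm]

/-! ### Talagrand's inequality on the line -/

section Rearrangement

variable {ν : Measure ℝ} [IsProbabilityMeasure ν]

theorem integral_comp_gaussianRearrangement [NullSingletonClass ν] {f : ℝ → ℝ}
    (hf : Measurable f) :
    ∫ x, f (gaussianRearrangement ν x) ∂ν = ∫ y, f y ∂(gaussianReal 0 1) := by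
  rw [← map_gaussianRearrangement (ν := ν), integral_map
    (measurable_gaussianRearrangement ν).aemeasurable hf.aestronglyMeasurable]

theorem integrable_comp_gaussianRearrangement [NullSingletonClass ν] {f : ℝ → ℝ}
    (hf : Integrable f (gaussianReal 0 1)) :
    Integrable (fun x => f (gaussianRearrangement ν x)) ν := by
  rw [← map_gaussianRearrangement (ν := ν)] at hf
  exact hf.comp_measurable (measurable_gaussianRearrangement ν)

theorem integrable_id_gaussianReal : Integrable (fun y : ℝ => y) (gaussianReal 0 1) :=
  memLp_one_iff_integrable.1 (memLp_id_gaussianReal' 1 (by simp))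

theorem integrable_sq_gaussianReal : Integrable (fun y : ℝ => y ^ 2) (gaussianReal 0 1) :=
  (memLp_id_gaussianReal' 2 (by simp)).integrable_sq

theorem integral_sq_gaussianReal : ∫ y, y ^ 2 ∂(gaussianReal 0 1) = 1 := by
  have h := variance_fun_id_gaussianReal (μ := 0) (v := 1)
  rw [variance_of_integral_eq_zero (by fun_prop) (by simp)] at h
  simpa using h

theorem integrable_mul_gaussianRearrangement [NullSingletonClass ν]
    (hx : Integrable (fun x => x ^ 2) ν) :
    Integrable (fun x => x * gaussianRearrangement ν x) ν :=
  MemLp.integrable_mul (p := 2) (q := 2)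
    ((memLp_two_iff_integrable_sq (by fun_prop)).2 hx)
    ((memLp_two_iff_integrable_sq (measurable_gaussianRearrangement ν).aestronglyMeasurable).2
      (integrable_comp_gaussianRearrangement integrable_sq_gaussianReal))

theorem setIntegral_Ioi_gaussianRearrangement [NullSingletonClass ν] {x : ℝ}
    (hx : ν.real (Iic x) ∈ Ioo (0 : ℝ) 1) :
    ∫ t in Ioi x, gaussianRearrangement ν t ∂ν =
      gaussianPDFReal 0 1 (gaussianRearrangement ν x) := by
  have hm := measurable_gaussianRearrangement ν
  rw [← setIntegral_Ioi_id_gaussianReal,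
    ← setIntegral_congr_set (Ioi_ae_eq_setOf_lt_gaussianRearrangement hx)]
  rw [← map_gaussianRearrangement (ν := ν), setIntegral_map measurableSet_Ioi
    (by fun_prop) hm.aemeasurable]
  rfl

/-- When the distribution function is `0` or `1` at `x`, the tail has full or zero mass, and the
rearrangement has mean zero. -/
theorem setIntegral_Ioi_gaussianRearrangement_nonneg [NullSingletonClass ν] (x : ℝ) :
    0 ≤ ∫ t in Ioi x, gaussianRearrangement ν t ∂ν := by
  by_cases hx : ν.real (Iic x) ∈ Ioo (0 : ℝ) 1
  · rw [setIntegral_Ioi_gaussianRearrangement hx]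
    exact gaussianPDFReal_nonneg _ _ _
  · refine le_of_eq (Eq.symm ?_)
    have h01 : ν.real (Iic x) = 0 ∨ ν.real (Iic x) = 1 := by
      by_contra! h
      exact hx ⟨measureReal_nonneg.lt_of_ne h.1.symm, measureReal_le_one.lt_of_ne h.2⟩
    rcases h01 with h | h
    · rw [measureReal_eq_zero_iff] at h
      have h2 : (Ioi x : Set ℝ) =ᵐ[ν] univ := by
        rw [← compl_Iic]
        exact ae_eq_univ.2 (by simpa using h)
      rw [setIntegral_congr_set h2, setIntegral_univ]
      exact (integral_comp_gaussianRearrangement measurable_id).trans (by simp)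
    · have h3 : ν (Ioi x) = 0 := by
        rw [← measureReal_eq_zero_iff, ← compl_Iic, probReal_compl_eq_one_sub measurableSet_Iic, h,
          sub_self]
      rw [Measure.restrict_eq_zero.2 h3, integral_zero_measure]

/-- The density ratio between the Gaussian measure at the image point and `ν`: formally the inverse
of the derivative of the rearrangement. -/
noncomputable def gaussianRatio (ν : Measure ℝ) (x : ℝ) : ℝ :=
  gaussianPDFReal 0 1 (gaussianRearrangement ν x) /
    ((ν.rnDeriv (gaussianReal 0 1) x).toReal * gaussianPDFReal 0 1 x)

theorem measurable_gaussianRatio : Measurable (gaussianRatio ν) :=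
  ((measurable_gaussianPDFReal 0 1).comp (measurable_gaussianRearrangement ν)).div
    ((Measure.measurable_rnDeriv _ _).ennreal_toReal.mul (measurable_gaussianPDFReal 0 1))

omit [IsProbabilityMeasure ν] in
theorem gaussianRatio_nonneg (x : ℝ) : 0 ≤ gaussianRatio ν x :=
  div_nonneg (gaussianPDFReal_nonneg _ _ _)
    (mul_nonneg ENNReal.toReal_nonneg (gaussianPDFReal_nonneg _ _ _))

/-- Multiplying the ratio by the Lebesgue density of `ν` leaves `φ(S(x))`, which is the tail
integral of `S` beyond `x`; `integral_setIntegral_Ioi` then integrates it. Only an inequality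
results, since points of zero density are lost on the left. -/
theorem integral_gaussianRatio_le (hν : ν ≪ gaussianReal 0 1)
    (hx : Integrable (fun x => x ^ 2) ν) [NullSingletonClass ν] :
    Integrable (gaussianRatio ν) ν ∧
      ∫ x, gaussianRatio ν x ∂ν ≤ ∫ x, x * gaussianRearrangement ν x ∂ν := by
  set S := gaussianRearrangement ν
  set A := {x | ν.real (Iic x) ∈ Ioo (0 : ℝ) 1}
  have hSm : Measurable S := measurable_gaussianRearrangement ν
  have hAm : MeasurableSet A := (continuous_real_Iic ν).measurable measurableSet_Ioo
  have hxS : Integrable (fun x => x * S x) ν := integrable_mul_gaussianRearrangement hx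
  obtain ⟨hm, hm_eq⟩ := integral_setIntegral_Ioi
    (integrable_comp_gaussianRearrangement integrable_id_gaussianReal)
    ((integral_comp_gaussianRearrangement measurable_id).trans (by simp)) hxS
  have hrm : Measurable fun x => ENNReal.ofReal (gaussianRatio ν x) :=
    measurable_gaussianRatio.ennreal_ofReal
  have key : ∫⁻ x, ENNReal.ofReal (gaussianRatio ν x) ∂ν ≤
      ∫⁻ x, ENNReal.ofReal (∫ t in Ioi x, S t ∂ν) := by
    calc ∫⁻ x, ENNReal.ofReal (gaussianRatio ν x) ∂ν
        -- `A` is `ν`-conull but perhaps not Lebesgue-conull, and `φ(S(x))` is meaningless off `A`,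
        -- so the indicator enters before passing to Lebesgue measure.
        = ∫⁻ x, A.indicator (fun x => ENNReal.ofReal (gaussianRatio ν x)) x ∂ν := by
          refine lintegral_congr_ae ?_
          filter_upwards [ae_real_Iic_mem_Ioo ν] with x hx
          rw [indicator_of_mem (show x ∈ A from hx)]
      _ = ∫⁻ x, ν.rnDeriv (gaussianReal 0 1) x *
            A.indicator (fun x => ENNReal.ofReal (gaussianRatio ν x)) x ∂(gaussianReal 0 1) :=
          (lintegral_rnDeriv_mul hν (hrm.indicator hAm).aemeasurable).symm
      _ = ∫⁻ x, gaussianPDF 0 1 x * (ν.rnDeriv (gaussianReal 0 1) x *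
            A.indicator (fun x => ENNReal.ofReal (gaussianRatio ν x)) x) := by
          have := lintegral_withDensity_eq_lintegral_mul volume (measurable_gaussianPDF 0 1)
            ((Measure.measurable_rnDeriv ν (gaussianReal 0 1)).mul (hrm.indicator hAm))
          rwa [← gaussianReal_of_var_ne_zero _ one_ne_zero] at this
      _ ≤ ∫⁻ x, ENNReal.ofReal (∫ t in Ioi x, S t ∂ν) := by
          have hfin : ∀ᵐ x, ν.rnDeriv (gaussianReal 0 1) x ≠ ∞ :=
            (gaussianReal_absolutelyContinuous' 0 one_ne_zero).ae_le (Measure.rnDeriv_ne_top ν _)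
          refine lintegral_mono_ae ?_
          filter_upwards [hfin] with x hfx
          by_cases hx : x ∈ A
          · rw [indicator_of_mem hx, setIntegral_Ioi_gaussianRearrangement hx]
            rw [← ENNReal.ofReal_toReal hfx, gaussianPDF, ← ENNReal.ofReal_mul ENNReal.toReal_nonneg,
              ← ENNReal.ofReal_mul (gaussianPDFReal_nonneg _ _ _)]
            refine ENNReal.ofReal_le_ofReal ?_
            have hp := gaussianPDFReal_pos 0 1 x one_ne_zero
            rcases (ENNReal.toReal_nonneg (a := ν.rnDeriv (gaussianReal 0 1) x)).eq_or_lt with h | h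
            · rw [← h]
              simpa using gaussianPDFReal_nonneg _ _ _
            · rw [gaussianRatio]
              refine le_of_eq ?_
              field_simp
          · simp [indicator_of_notMem hx]
  rw [← ofReal_integral_eq_lintegral_ofReal hm
    (ae_of_all _ setIntegral_Ioi_gaussianRearrangement_nonneg)] at key
  have hr : Integrable (gaussianRatio ν) ν :=
    ⟨measurable_gaussianRatio.aestronglyMeasurable, by
      rw [hasFiniteIntegral_iff_ofReal (ae_of_all _ gaussianRatio_nonneg)]
      exact key.trans_lt ENNReal.ofReal_lt_top⟩
  rw [← ofReal_integral_eq_lintegral_ofReal hr (ae_of_all _ gaussianRatio_nonneg),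
    ENNReal.ofReal_le_ofReal_iff
      (integral_nonneg setIntegral_Ioi_gaussianRearrangement_nonneg)] at key
  exact ⟨hr, key.trans_eq hm_eq⟩

/-- Talagrand's inequality on the line, realized by the increasing rearrangement. -/
theorem lintegral_edist_gaussianRearrangement_sq_le (hν : ν ≪ gaussianReal 0 1) :
    ∫⁻ x, edist x (gaussianRearrangement ν x) ^ 2 ∂ν ≤ 2 * klDiv ν (gaussianReal 0 1) := by
  have : NullSingletonClass ν := ⟨fun x => hν (measure_singleton x)⟩
  by_cases hfin : klDiv ν (gaussianReal 0 1) = ∞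
  · simp [hfin]
  obtain ⟨-, hllr⟩ := klDiv_ne_top_iff.1 hfin
  set S := gaussianRearrangement ν
  have hSm : Measurable S := measurable_gaussianRearrangement ν
  have hx2 := integrable_sq_of_integrable_llr hν hllr
  have hS2 : Integrable (fun x => S x ^ 2) ν :=
    integrable_comp_gaussianRearrangement integrable_sq_gaussianReal
  have hS2_eq : ∫ x, S x ^ 2 ∂ν = 1 :=
    (integral_comp_gaussianRearrangement (f := fun y => y ^ 2) (by fun_prop)).trans
      integral_sq_gaussianReal
  have hxS : Integrable (fun x => x * S x) ν := integrable_mul_gaussianRearrangement hx2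
  obtain ⟨hr, hr_le⟩ := integral_gaussianRatio_le hν hx2
  have hpt : ∀ᵐ x ∂ν, (x ^ 2 - S x ^ 2) / 2 - llr ν (gaussianReal 0 1) x ≤
      gaussianRatio ν x - 1 := by
    filter_upwards [Measure.rnDeriv_pos hν, hν.ae_le (Measure.rnDeriv_ne_top ν _)] with x hx0 hxtop
    have hx := ENNReal.toReal_pos hx0.ne' hxtop
    have hp := gaussianPDFReal_pos 0 1 x one_ne_zero
    have hpS := gaussianPDFReal_pos 0 1 (S x) one_ne_zero
    have h := Real.log_le_sub_one_of_pos (div_pos hpS (mul_pos hx hp))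
    rw [Real.log_div hpS.ne' (mul_pos hx hp).ne', Real.log_mul hx.ne' hp.ne',
      log_gaussianPDFReal_zero_one, log_gaussianPDFReal_zero_one] at h
    rw [llr, gaussianRatio]
    linarith
  have hdiff : Integrable (fun x => (x ^ 2 - S x ^ 2) / 2) ν := (hx2.sub hS2).div_const 2
  have hint := integral_mono_ae (hdiff.sub hllr) (hr.sub (integrable_const 1)) hpt
  simp only [Pi.sub_apply] at hint
  rw [integral_sub hdiff hllr, integral_sub hr (integrable_const 1),
    integral_div, integral_sub hx2 hS2, hS2_eq] at hint
  simp only [integral_const, probReal_univ, smul_eq_mul, one_mul] at hint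
  have hcost : Integrable (fun x => (x - S x) ^ 2) ν :=
    ((hx2.add hS2).sub (hxS.const_mul 2)).congr (ae_of_all _ fun x => by
      simp only [Pi.add_apply, Pi.sub_apply]; ring)
  have hcost_eq : ∫ x, (x - S x) ^ 2 ∂ν = ∫ x, x ^ 2 ∂ν + 1 - 2 * ∫ x, x * S x ∂ν := by
    have hadd : Integrable (fun x => x ^ 2 + S x ^ 2) ν := hx2.add hS2
    rw [← hS2_eq, ← integral_add hx2 hS2, ← integral_const_mul,
      ← integral_sub hadd (hxS.const_mul 2)]
    refine integral_congr_ae (ae_of_all _ fun x => ?_)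
    dsimp only
    ring
  have hlhs : ∫⁻ x, edist x (S x) ^ 2 ∂ν = ENNReal.ofReal (∫ x, (x - S x) ^ 2 ∂ν) := by
    rw [ofReal_integral_eq_lintegral_ofReal hcost (ae_of_all _ fun x => sq_nonneg _)]
    refine lintegral_congr fun x => ?_
    rw [edist_dist, Real.dist_eq, ← ENNReal.ofReal_pow (abs_nonneg _), sq_abs]
  rw [hlhs, klDiv_of_ac_of_integrable hν hllr, ← ENNReal.ofReal_ofNat 2,
    ← ENNReal.ofReal_mul zero_le_two]
  refine ENNReal.ofReal_le_ofReal ?_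
  -- The total-mass corrections in `klDiv` cancel.
  simp only [probReal_univ]
  linarith

end Rearrangement

end GaussianLine

/-! ### Tensorization -/

section Tensorization

/-- Under absolute continuity the joint density is the fibrewise density `κ.rnDeriv η`, and the two
sides agree; otherwise the right side is infinite. -/
theorem lintegral_klDiv_le_klDiv_compProd {X Y : Type*} [MeasurableSpace X] [MeasurableSpace Y]
    [MeasurableSpace.CountableOrCountablyGenerated X Y]
    (μ : Measure X) [IsFiniteMeasure μ] (κ η : Kernel X Y) [IsFiniteKernel κ] [IsFiniteKernel η] :
    ∫⁻ x, klDiv (κ x) (η x) ∂μ ≤ klDiv (μ ⊗ₘ κ) (μ ⊗ₘ η) := by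
  by_cases hac : μ ⊗ₘ κ ≪ μ ⊗ₘ η
  swap
  · simp [klDiv_of_not_ac hac]
  have hκη : ∀ᵐ x ∂μ, κ x ≪ η x := hac.kernel_of_compProd
  have hm : Measurable fun p : X × Y => κ.rnDeriv η p.1 p.2 := Kernel.measurable_rnDeriv κ η
  have hdens : μ ⊗ₘ κ = (μ ⊗ₘ η).withDensity fun p => κ.rnDeriv η p.1 p.2 := by
    rw [← Measure.compProd_withDensity hm]
    exact Measure.compProd_congr (hκη.mono fun x hx => (Kernel.withDensity_rnDeriv_eq hx).symm)
  have hrn : (μ ⊗ₘ κ).rnDeriv (μ ⊗ₘ η) =ᵐ[μ ⊗ₘ η] fun p => κ.rnDeriv η p.1 p.2 := by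
    rw [hdens]
    exact Measure.rnDeriv_withDensity _ hm
  rw [klDiv_eq_lintegral_klFun_of_ac hac]
  refine le_of_eq ?_
  have h2 : ∫⁻ p, ENNReal.ofReal (klFun ((μ ⊗ₘ κ).rnDeriv (μ ⊗ₘ η) p).toReal) ∂(μ ⊗ₘ η) =
      ∫⁻ p : X × Y, ENNReal.ofReal (klFun (κ.rnDeriv η p.1 p.2).toReal) ∂(μ ⊗ₘ η) := by
    refine lintegral_congr_ae ?_
    filter_upwards [hrn] with p hp
    rw [hp]
  have hmk : Measurable fun p : X × Y => ENNReal.ofReal (klFun (κ.rnDeriv η p.1 p.2).toReal) :=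
    (measurable_klFun.comp hm.ennreal_toReal).ennreal_ofReal
  rw [h2, Measure.lintegral_compProd hmk]
  refine lintegral_congr_ae ?_
  filter_upwards [hκη] with x hx
  rw [klDiv_eq_lintegral_klFun_of_ac hx]
  refine lintegral_congr_ae ?_
  filter_upwards [Kernel.rnDeriv_eq_rnDeriv_measure (κ := κ) (η := η) (a := x)] with y hy
  rw [hy]

/-- Every probability measure `ν ≪ γ` is pushed to `γ` by a map whose transport cost for the ground
cost `c` is at most `2 * klDiv ν γ`. -/
def TransportInequality {X : Type*} [MeasurableSpace X] (c : X → X → ℝ≥0∞) (γ : Measure X) : Prop :=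
  ∀ ν : Measure X, IsProbabilityMeasure ν → ν ≪ γ →
    ∃ S : X → X, Measurable S ∧ ν.map S = γ ∧ ∫⁻ x, c x (S x) ∂ν ≤ 2 * klDiv ν γ

theorem TransportInequality.prod_gaussianReal {X : Type*} [MeasurableSpace X]
    {c : X → X → ℝ≥0∞} (hc : Measurable (Function.uncurry c)) {γ : Measure X}
    [IsProbabilityMeasure γ] (h : TransportInequality c γ) :
    TransportInequality (fun p q : X × ℝ => c p.1 q.1 + edist p.2 q.2 ^ 2)
      (γ.prod (gaussianReal 0 1)) := by
  intro ν _ hν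
  set η : Kernel X ℝ := Kernel.const X (gaussianReal 0 1)
  set κ := ν.condKernel
  have hdis : ν.fst ⊗ₘ κ = ν := ν.disintegrate κ
  have hγ : γ ⊗ₘ η = γ.prod (gaussianReal 0 1) := Measure.compProd_const
  have hac : ν.fst ⊗ₘ κ ≪ γ ⊗ₘ η := by rwa [hdis, hγ]
  obtain ⟨hac1, hac2⟩ := Measure.absolutelyContinuous_compProd_iff'.1 hac
  obtain ⟨T, hT, hT_map, hT_cost⟩ := h ν.fst inferInstance hac1
  have hR : Measurable fun p : X × ℝ => gaussianRearrangement (κ p.1) p.2 :=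
    measurable_gaussianRearrangement_kernel κ
  have hmap : ∀ᵐ x ∂ν.fst, (κ x).map (gaussianRearrangement (κ x)) = gaussianReal 0 1 := by
    filter_upwards [hac2] with x hx
    have : NullSingletonClass (κ x) := ⟨fun y => hx (measure_singleton (μ := gaussianReal 0 1) y)⟩
    exact map_gaussianRearrangement
  -- A triangular (Knothe) map: given the first coordinate, the second becomes Gaussian whatever
  -- that coordinate is, hence the product law.
  refine ⟨fun p => (T p.1, gaussianRearrangement (κ p.1) p.2), by fun_prop, ?_, ?_⟩
  · refine Measure.ext_of_lintegral _ fun f hf => ?_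
    conv_lhs => rw [← hdis]
    rw [lintegral_map hf (by fun_prop), Measure.lintegral_compProd (by fun_prop),
      lintegral_prod _ hf.aemeasurable, ← hT_map, lintegral_map (by fun_prop) hT]
    refine lintegral_congr_ae ?_
    filter_upwards [hmap] with x hx
    conv_rhs => rw [← hx]
    rw [lintegral_map (by fun_prop) (measurable_gaussianRearrangement _)]
  · have hcT : Measurable fun x => c x (T x) := hc.comp (measurable_id.prodMk hT)
    have hcT' : Measurable fun p : X × ℝ => c p.1 (T p.1) := hcT.comp measurable_fst
    have hcR : Measurable fun p : X × ℝ => edist p.2 (gaussianRearrangement (κ p.1) p.2) ^ 2 :=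
      (measurable_snd.edist hR).pow_const 2
    calc ∫⁻ p, c p.1 (T p.1) + edist p.2 (gaussianRearrangement (κ p.1) p.2) ^ 2 ∂ν
        = ∫⁻ x, c x (T x) ∂ν.fst +
          ∫⁻ x, ∫⁻ y, edist y (gaussianRearrangement (κ x) y) ^ 2 ∂κ x ∂ν.fst := by
          rw [lintegral_add_left hcT', ← Measure.lintegral_compProd hcR, hdis,
            Measure.fst, lintegral_map hcT measurable_fst]
      _ ≤ 2 * klDiv ν.fst γ + ∫⁻ x, 2 * klDiv (κ x) (η x) ∂ν.fst := by
          refine add_le_add hT_cost (lintegral_mono_ae ?_)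
          filter_upwards [hac2] with x hx
          exact lintegral_edist_gaussianRearrangement_sq_le hx
      _ = 2 * klDiv ν.fst γ + 2 * ∫⁻ x, klDiv (κ x) (η x) ∂ν.fst := by
          rw [lintegral_const_mul' _ _ (by simp)]
      _ ≤ 2 * klDiv ν.fst γ + 2 * klDiv (ν.fst ⊗ₘ κ) (ν.fst ⊗ₘ η) := by
          gcongr
          exact lintegral_klDiv_le_klDiv_compProd _ _ _
      _ = 2 * klDiv ν (γ.prod (gaussianReal 0 1)) := by
          rw [← mul_add, ← klDiv_compProd_eq_add, hdis, hγ]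

/-- Conjugate the map by `e`; data processing keeps the entropy from growing. -/
theorem TransportInequality.of_measurePreserving {X Y : Type*} [MeasurableSpace X]
    [MeasurableSpace Y] {c : X → X → ℝ≥0∞} {d : Y → Y → ℝ≥0∞} {γ : Measure X} {ρ : Measure Y}
    [IsFiniteMeasure γ] (e : X ≃ᵐ Y) (he : MeasurePreserving e γ ρ)
    (hcd : ∀ x y, c x y = d (e x) (e y)) (hd : Measurable (Function.uncurry d))
    (h : TransportInequality d ρ) : TransportInequality c γ := by
  intro ν _ hν
  obtain ⟨S, hS, hS_map, hS_cost⟩ := h (ν.map e)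
    (Measure.isProbabilityMeasure_map e.measurable.aemeasurable)
    (he.map_eq ▸ hν.map e.measurable)
  refine ⟨e.symm ∘ S ∘ e, by fun_prop, ?_, ?_⟩
  · rw [← Measure.map_map e.symm.measurable (by fun_prop), ← Measure.map_map hS e.measurable,
      hS_map, ← he.map_eq, e.map_symm_map]
  · have hdS : Measurable fun y => d y (S y) := hd.comp (measurable_id.prodMk hS)
    rw [lintegral_map hdS e.measurable] at hS_cost
    simp only [hcd, Function.comp_apply, e.apply_symm_apply]
    refine hS_cost.trans ?_
    rw [← he.map_eq]
    gcongr
    exact klDiv_map_le ν γ e.measurable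

theorem transportInequality_pi_gaussianReal (n : ℕ) :
    TransportInequality (fun x y : Fin n → ℝ => ∑ i, edist (x i) (y i) ^ 2)
      (Measure.pi fun _ => gaussianReal 0 1) := by
  induction n with
  | zero =>
    intro ν _ hν
    refine ⟨id, measurable_id, ?_, by simp⟩
    rw [Measure.map_id]
    refine Measure.ext fun s _ => ?_
    rcases s.eq_empty_or_nonempty with rfl | hs
    · simp
    · simp [Subsingleton.eq_univ_of_nonempty hs]
  | succ n ih =>
    -- The swap is needed because `piFinSuccAbove` puts the split coordinate first, while the
    -- product step adds the real factor second.
    have he := (Measure.measurePreserving_swap (μ := gaussianReal 0 1)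
      (ν := Measure.pi fun _ : Fin n => gaussianReal 0 1)).comp
      (measurePreserving_piFinSuccAbove (fun _ : Fin (n + 1) => gaussianReal 0 1) 0)
    refine TransportInequality.of_measurePreserving
      ((MeasurableEquiv.piFinSuccAbove (fun _ => ℝ) 0).trans MeasurableEquiv.prodComm) he
      (fun x y => ?_) ?_ (ih.prod_gaussianReal ?_)
    · rw [Fin.sum_univ_succ, add_comm]
      rfl
    · unfold Function.uncurry
      fun_prop
    · unfold Function.uncurry
      fun_prop

theorem transportInequality_stdGaussian (n : ℕ) :
    TransportInequality (fun x y : EuclideanSpace ℝ (Fin n) => edist x y ^ 2)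
      (stdGaussian (EuclideanSpace ℝ (Fin n))) := by
  refine TransportInequality.of_measurePreserving
    (MeasurableEquiv.toLp 2 (Fin n → ℝ)).symm
    (MeasurePreserving.symm _ ⟨(MeasurableEquiv.toLp 2 (Fin n → ℝ)).measurable,
      map_pi_eq_stdGaussian⟩)
    (fun x y => ?_) ?_ (transportInequality_pi_gaussianReal n)
  · rw [EuclideanSpace.edist_eq, ← ENNReal.rpow_natCast, ← ENNReal.rpow_mul]
    simp
  · unfold Function.uncurry
    fun_prop

end Tensorization

/-! ### Transfer to `E` -/

theorem theorem8p1 {E : Type*} [MeasurableSpace E] {n : ℕ}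
    (ψ : E ≃ᵐ EuclideanSpace ℝ (Fin n)) (μ : Measure E) [IsProbabilityMeasure μ]
    (hμ : μ.map ψ = stdGaussian (EuclideanSpace ℝ (Fin n)))
    (ν : Measure E) [IsProbabilityMeasure ν] (hν : ν ≪ μ) :
    psiWasserstein 2 ψ ν μ ≤ (2 * klDiv ν μ) ^ (1 / 2 : ℝ) := by
  obtain ⟨S, hS, hS_map, hS_cost⟩ := transportInequality_stdGaussian n (ν.map ψ)
    (Measure.isProbabilityMeasure_map ψ.measurable.aemeasurable) (hμ ▸ hν.map ψ.measurable)
  unfold psiWasserstein wasserstein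
  refine ENNReal.rpow_le_rpow ?_ (by norm_num)
  -- The coupling carried by the graph of `S`.
  refine iInf₂_le_of_le ((ν.map ψ).map fun x => (x, S x)) ⟨?_, ?_⟩ ?_
  · rw [Measure.map_map measurable_fst (by fun_prop)]
    exact Measure.map_id
  · rw [Measure.map_map measurable_snd (by fun_prop), hμ]
    exact hS_map
  · rw [lintegral_map (by fun_prop) (by fun_prop)]
    simp only [ENNReal.rpow_two]
    refine hS_cost.trans ?_
    rw [← hμ]
    gcongr
    exact klDiv_map_le ν μ ψ.measurable
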